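/- **Setting (Repeated Joint Ads problem).** A mechanism for two agents consists of an allocation rule $x:[0,1]^2\to\{0,1\}$ (a non-excludable good: both agents or none are served) and payment functions $p_1,p_2:[0,1]^2\to[0,1]$. An agent $i$ with valuation $v_i$ has utility $v_i\,x(b_1,b_2)-p_i(b_1,b_2)$ when the bids are $(b_1,b_2)$. Let $\mathcal M$ be the class of all mechanisms that are dominant-strategy incentive compatible (for every bid of the other agent, truthful bidding maximizes the agent's utility) and ex-post individually rational (truthful bidding never gives negative utility), and whose allocation region $\{x=1\}$ is closed. The revenue of $M=(x,p_1,p_2)$ on (truthfully reported) valuations $v=(v_1,v_2)$ is $\mathsf{rev}(M,v)=x(v)\,(p_1(v)+p_2(v))$. In each round $t=1,\dots,T$ a learning algorithm $\mathcal A$ proposes a mechanism $M^t\in\mathcal M$ depending on the valuations $v^1,\dots,v^{t-1}$ of the earlier rounds (measurably, in the sense that $\mathsf{rev}(M^t,v^t)$ is a measurable function of $(v^1,\dots,v^t)$), gains $\mathsf{rev}(M^t,v^t)$ and observes $v^t\in[0,1]^2$. In the stochastic i.i.d. setting the pairs $v^1,\dots,v^T$ are drawn independently from one unknown, possibly correlated,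 probability distribution $\mu$ on $[0,1]^2$, and $$R_T(\mathcal A)=\sup_{\mu}\ \sup_{M\in\mathcal M}\ \mathbb E_{v^1,\dots,v^T\sim\mu}\Big[\sum_{t=1}^T\mathsf{rev}(M,v^t)-\sum_{t=1}^T\mathsf{rev}(M^t,v^t)\Big].$$ **Theorem.** For every horizon $T\ge 2$ there exists a (deterministic) learning algorithm $\mathcal A$, which may depend on $T$ but not on $\mu$, such that $$R_T(\mathcal A)\le 35\,\sqrt[4]{T^3\log T},$$ where $\log$ is the natural logarithm. -/

import Mathlib

open MeasureTheory

noncomputable section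

namespace JointAds

/-- A pair of valuations (or of bids) of the two agents: a point of the square `[0,1]²`. -/
abbrev Profile : Type := unitInterval × unitInterval

/-- The quasi-linear utility `v · x - p` of an agent with private valuation `v` when the allocation
is `x ∈ {0,1}` and the agent pays `p`. -/
def utility (v : unitInterval) (x : Bool) (p : unitInterval) : ℝ :=
  (v : ℝ) * (if x then 1 else 0) - p

/-- A (non-excludable) DSIC and IR mechanism for two agents. By convention the set of bid profiles
at which the mechanism allocates is closed. -/
structure Mechanism where
  /-- the allocation rule `x : [0,1]² → {0,1}`, common to both agents -/
  alloc : Profile → Bool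
  /-- the payment function `p₁ : [0,1]² → [0,1]` of the first agent -/
  pay₁ : Profile → unitInterval
  /-- the payment function `p₂ : [0,1]² → [0,1]` of the second agent -/
  pay₂ : Profile → unitInterval
  /-- truthfulness is a dominant strategy for the first agent -/
  dsic₁ : ∀ v₁ b₁ b₂ : unitInterval,
    utility v₁ (alloc (b₁, b₂)) (pay₁ (b₁, b₂)) ≤ utility v₁ (alloc (v₁, b₂)) (pay₁ (v₁, b₂))
  /-- truthfulness is a dominant strategy for the second agent -/
  dsic₂ : ∀ v₂ b₁ b₂ : unitInterval,
    utility v₂ (alloc (b₁, b₂)) (pay₂ (b₁, b₂)) ≤ utility v₂ (alloc (b₁, v₂)) (pay₂ (b₁, v₂))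
  /-- ex-post individual rationality for the first agent -/
  ir₁ : ∀ v₁ b₂ : unitInterval, 0 ≤ utility v₁ (alloc (v₁, b₂)) (pay₁ (v₁, b₂))
  /-- ex-post individual rationality for the second agent -/
  ir₂ : ∀ v₂ b₁ : unitInterval, 0 ≤ utility v₂ (alloc (b₁, v₂)) (pay₂ (b₁, v₂))
  /-- the allocation region is closed -/
  isClosed_region : IsClosed {b : Profile | alloc b = true}

/-- The revenue `x(v) · (p₁(v) + p₂(v))` of a mechanism on (truthfully reported) valuations `v`. -/
def Mechanism.revenue (M : Mechanism) (v : Profile) : ℝ :=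
  (if M.alloc v then 1 else 0) * ((M.pay₁ v : ℝ) + (M.pay₂ v : ℝ))

/-- A deterministic learning algorithm with horizon `T`: in round `t` (rounds are numbered
`0, …, T - 1`) it chooses a mechanism as a function of the valuations of the `t` earlier rounds.
The measurability requirement makes the expected revenue of every round meaningful. -/
structure LearningAlgorithm (T : ℕ) where
  choose : (t : Fin T) → (Fin t → Profile) → Mechanism
  measurable_revenue : ∀ t : Fin T,
    Measurable fun q : (Fin t → Profile) × Profile => (choose t q.1).revenue q.2

/-- The mechanism posted in round `t` when the sequence of valuations is `v`. -/
def LearningAlgorithm.posted {T : ℕ} (A : LearningAlgorithm T) (v : Fin T → Profile)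
    (t : Fin T) : Mechanism :=
  A.choose t fun s => v (Fin.castLE t.isLt.le s)

/-- The regret of `A` when the `T` valuation pairs are drawn i.i.d. from `μ`: the supremum over all
fixed mechanisms `M` of the expectation of `∑ₜ rev(M, vₜ) - ∑ₜ rev(Mₜ, vₜ)`. -/
def LearningAlgorithm.regret {T : ℕ} (A : LearningAlgorithm T) (μ : ProbabilityMeasure Profile) :
    EReal :=
  ⨆ M : Mechanism,
    ((∫ v : Fin T → Profile,
        (∑ t, M.revenue (v t) - ∑ t, (A.posted v t).revenue (v t))
        ∂(Measure.pi fun _ : Fin T => (μ : Measure Profile)) : ℝ) : EReal)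

/-- The regret of `A` in the stochastic setting: the supremum of its regret over all (possibly
correlated) distributions of the valuation pair. -/
def LearningAlgorithm.stochasticRegret {T : ℕ} (A : LearningAlgorithm T) : EReal :=
  ⨆ μ : ProbabilityMeasure Profile, A.regret μ

end JointAds

end

/-! By incentive compatibility and individual rationality, the allocation region is an up-set and,
on it, each payment is the infimum of the winning bids, so revenue is determined by the region. Cut
the square into `2 * G` strips of width `1 / G` parallel to the diagonal and replace the region in
each strip by the quadrant above its componentwise minimum. Since the two coordinates move together
along such a strip, one corner controls both prices up to `1 / G`, and the resulting staircase loses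
at most `2 / G` of revenue (`Mechanism.exists_stair`).

Revenue is discontinuous in the corners, so they cannot be put on a fixed grid. They are rounded up
to coordinates of `m` sampled valuations instead. This never lowers a price, and a sale is lost only
if a fresh valuation falls into one of `4 * G` gaps, each of expected mass at most `1 / (m + 1)` by
exchangeability (`exists_cornerIndex`, `integral_measure_strict_min_le`). At most `(m + 1) ^ (4 *
G)` staircases remain, and a second, independent sample of size `m` selects an empirical maximizer
among them; a Hoeffding-type bound controls its error (`integral_le_integral_argmax_add`).

Exploring for `2 * m` rounds and then committing, with `m ≈ T * d`, `G ≈ 1 / d` and `d = (log T / T)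
^ (1 / 4)`, makes every loss at most of order `T * d`, which is the fourth root of `T ^ 3 * log T`.
-/

noncomputable section

namespace JointAds

/-! ### Critical prices and staircase mechanisms -/

open scoped Classical in
/-- The critical price `min {x k | y k ≤ b}`, and `1` when there is no such `k`. -/
def price {ι : Type*} [Fintype ι] (x y : ι → unitInterval) (b : unitInterval) : unitInterval :=
  Finset.univ.inf fun k => if y k ≤ b then x k else 1

section price

variable {ι : Type*} [Fintype ι]

theorem price_le {x y : ι → unitInterval} {b : unitInterval} {k : ι} (h : y k ≤ b) :
    price x y b ≤ x k := by
  refine (Finset.inf_le (Finset.mem_univ k)).trans ?_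
  simp [h]

theorem le_price {x y : ι → unitInterval} {b c : unitInterval} (h : ∀ k, y k ≤ b → c ≤ x k) :
    c ≤ price x y b := by
  refine Finset.le_inf fun k _ => ?_
  split_ifs with hk
  · exact h k hk
  · exact unitInterval.le_one'

theorem price_mono {x y x' y' : ι → unitInterval} (hx : x ≤ x') (hy : y ≤ y') (b : unitInterval) :
    price x y b ≤ price x' y' b :=
  le_price fun k hk => (price_le ((hy k).trans hk)).trans (hx k)

/-- Up to an additive error, lower bounds on the eligible `x k` bound the price from below. -/
theorem le_price_add {x y : ι → unitInterval} {b : unitInterval} {p e : ℝ} (hp : p ≤ 1)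
    (he : 0 ≤ e) (h : ∀ k, y k ≤ b → p ≤ x k + e) : p ≤ price x y b + e := by
  -- The bound `p - e` must lie in `[0,1]` to be compared with a price; if it is negative there is
  -- nothing to prove.
  by_cases h0 : p - e ≤ 0
  · have := (price x y b).2.1
    linarith
  · have hmem : p - e ∈ unitInterval := ⟨by linarith, by linarith⟩
    have : (⟨p - e, hmem⟩ : unitInterval) ≤ price x y b :=
      le_price fun k hk => by
        rw [← Subtype.coe_le_coe]
        have := h k hk
        simp only
        linarith
    rw [← Subtype.coe_le_coe] at this
    simp only at this
    linarith

theorem measurable_price :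
    Measurable fun q : ((ι → unitInterval) × (ι → unitInterval)) × unitInterval =>
      price q.1.1 q.1.2 q.2 := by
  classical
  unfold price
  have key : ∀ s : Finset ι,
      Measurable fun q : ((ι → unitInterval) × (ι → unitInterval)) × unitInterval =>
        s.inf fun k => if q.1.2 k ≤ q.2 then q.1.1 k else 1 := by
    intro s
    induction s using Finset.induction_on with
    | empty => simp
    | insert a s ha ih =>
      simp only [Finset.inf_insert]
      refine Measurable.inf (Measurable.ite (measurableSet_le ?_ ?_) ?_ measurable_const) ih
      all_goals fun_prop
  convert key Finset.univ

end price

open scoped Classical in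
/-- The staircase mechanism whose allocation region is the upper closure of the corners `C k`. -/
def stair {ι : Type*} [Fintype ι] (C : ι → Profile) : Mechanism where
  alloc v := decide (∃ k, C k ≤ v)
  pay₁ v := if ∃ k, C k ≤ v then price (fun k => (C k).1) (fun k => (C k).2) v.2 else 0
  pay₂ v := if ∃ k, C k ≤ v then price (fun k => (C k).2) (fun k => (C k).1) v.1 else 0
  dsic₁ v₁ b₁ b₂ := by
    by_cases h : ∃ k, C k ≤ (b₁, b₂) <;> by_cases h' : ∃ k, C k ≤ (v₁, b₂) <;>
      simp only [utility, h, h', decide_true, decide_false, if_true, if_false, le_refl,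
        Bool.false_eq_true]
    · have : v₁ ≤ price (fun k : ι => (C k).1) (fun k => (C k).2) b₂ :=
        le_price fun k hk => le_of_not_ge fun h1 => h' ⟨k, h1, hk⟩
      simpa using this
    · obtain ⟨k, hk⟩ := h'
      have : price (fun k : ι => (C k).1) (fun k => (C k).2) b₂ ≤ v₁ := (price_le (k := k) hk.2).trans hk.1
      simpa using this
  dsic₂ v₂ b₁ b₂ := by
    by_cases h : ∃ k, C k ≤ (b₁, b₂) <;> by_cases h' : ∃ k, C k ≤ (b₁, v₂) <;>
      simp only [utility, h, h', decide_true, decide_false, if_true, if_false, le_refl,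
        Bool.false_eq_true]
    · have : v₂ ≤ price (fun k : ι => (C k).2) (fun k => (C k).1) b₁ :=
        le_price fun k hk => le_of_not_ge fun h1 => h' ⟨k, hk, h1⟩
      simpa using this
    · obtain ⟨k, hk⟩ := h'
      have : price (fun k : ι => (C k).2) (fun k => (C k).1) b₁ ≤ v₂ := (price_le (k := k) hk.1).trans hk.2
      simpa using this
  ir₁ v₁ b₂ := by
    by_cases h' : ∃ k, C k ≤ (v₁, b₂) <;>
      simp only [utility, h', decide_true, decide_false, if_true, if_false, Bool.false_eq_true]
    · obtain ⟨k, hk⟩ := h'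
      have : price (fun k : ι => (C k).1) (fun k => (C k).2) b₂ ≤ v₁ := (price_le (k := k) hk.2).trans hk.1
      simpa using this
    · simp
  ir₂ v₂ b₁ := by
    by_cases h' : ∃ k, C k ≤ (b₁, v₂) <;>
      simp only [utility, h', decide_true, decide_false, if_true, if_false, Bool.false_eq_true]
    · obtain ⟨k, hk⟩ := h'
      have : price (fun k : ι => (C k).2) (fun k => (C k).1) b₁ ≤ v₂ := (price_le (k := k) hk.1).trans hk.2
      simpa using this
    · simp
  isClosed_region := by
    have : {b : Profile | decide (∃ k, C k ≤ b) = true} = ⋃ k, Set.Ici (C k) := by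
      ext b; simp
    rw [this]
    exact isClosed_iUnion_of_finite fun k => isClosed_Ici

theorem Mechanism.revenue_nonneg (M : Mechanism) (v : Profile) : 0 ≤ M.revenue v := by
  have h1 := (M.pay₁ v).2.1
  have h2 := (M.pay₂ v).2.1
  unfold Mechanism.revenue
  split_ifs <;> linarith

theorem Mechanism.revenue_le_two (M : Mechanism) (v : Profile) : M.revenue v ≤ 2 := by
  have h1 := (M.pay₁ v).2.2
  have h2 := (M.pay₂ v).2.2
  unfold Mechanism.revenue
  split_ifs <;> linarith

section stair

variable {ι : Type*} [Fintype ι]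

open scoped Classical in
theorem stair_revenue (C : ι → Profile) (v : Profile) :
    (stair C).revenue v = if ∃ k, C k ≤ v then
      (price (fun k => (C k).1) (fun k => (C k).2) v.2 : ℝ) +
        price (fun k => (C k).2) (fun k => (C k).1) v.1 else 0 := by
  by_cases h : ∃ k, C k ≤ v <;> simp [Mechanism.revenue, stair, h]

theorem measurable_stair_revenue :
    Measurable fun q : (ι → Profile) × Profile => (stair q.1).revenue q.2 := by
  classical
  simp only [stair_revenue]
  refine Measurable.ite ?_ ?_ measurable_const
  · have : {q : (ι → Profile) × Profile | ∃ k, q.1 k ≤ q.2} = ⋃ k, {q | q.1 k ≤ q.2} := by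
      ext; simp
    rw [this]
    exact MeasurableSet.iUnion fun k => measurableSet_le (by fun_prop) (by fun_prop)
  · refine Measurable.add ?_ ?_
    · exact measurable_subtype_coe.comp (measurable_price.comp
        (f := fun q : (ι → Profile) × Profile =>
          (((fun k => (q.1 k).1), (fun k => (q.1 k).2)), q.2.2)) (by fun_prop))
    · exact measurable_subtype_coe.comp (measurable_price.comp
        (f := fun q : (ι → Profile) × Profile =>
          (((fun k => (q.1 k).2), (fun k => (q.1 k).1)), q.2.1)) (by fun_prop))

/-- Moving the corners up loses revenue only where the allocation is lost. -/
theorem stair_revenue_le {C C' : ι → Profile} (h : C ≤ C') {v : Profile}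
    (hv : ∀ k, C k ≤ v → C' k ≤ v) : (stair C).revenue v ≤ (stair C').revenue v := by
  classical
  by_cases h1 : ∃ k, C k ≤ v
  · obtain ⟨k, hk⟩ := h1
    rw [stair_revenue, stair_revenue, if_pos ⟨k, hk⟩, if_pos ⟨k, hv k hk⟩]
    exact add_le_add
      (price_mono (fun k => (h k).1) (fun k => (h k).2) _)
      (price_mono (fun k => (h k).2) (fun k => (h k).1) _)
  · rw [stair_revenue, if_neg h1]
    exact Mechanism.revenue_nonneg _ _

end stair

/-! ### Structure of truthful mechanisms and their approximation by staircases -/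

section truthful

variable (M : Mechanism)

/-- Valuation `v.1` may misreport `b`, so it pays no more than `b` does, and individual rationality
caps that payment by `b`. -/
theorem Mechanism.pay₁_le {v : Profile} (hv : M.alloc v = true) {b : unitInterval}
    (hb : M.alloc (b, v.2) = true) : M.pay₁ v ≤ b := by
  have h1 := M.dsic₁ v.1 b v.2
  have h2 := M.dsic₁ b v.1 v.2
  have h3 := M.ir₁ b v.2
  simp only [utility, hb, hv, Prod.mk.eta, if_true] at h1 h2 h3
  rw [← Subtype.coe_le_coe]
  linarith

theorem Mechanism.pay₂_le {v : Profile} (hv : M.alloc v = true) {b : unitInterval}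
    (hb : M.alloc (v.1, b) = true) : M.pay₂ v ≤ b := by
  have h1 := M.dsic₂ v.2 v.1 b
  have h2 := M.dsic₂ b v.1 v.2
  have h3 := M.ir₂ b v.1
  simp only [utility, hb, hv, Prod.mk.eta, if_true] at h1 h2 h3
  rw [← Subtype.coe_le_coe]
  linarith

/-- If `a' > a` were excluded, its truthful utility would be at most `0`, whereas reporting `a`
yields at least `a' - a > 0`. -/
theorem Mechanism.alloc_mono₁ {a a' b : unitInterval} (h : M.alloc (a, b) = true) (ha : a ≤ a') :
    M.alloc (a', b) = true := by
  by_contra hn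
  rcases ha.eq_or_lt with rfl | hlt
  · exact hn h
  have h1 := M.dsic₁ a' a b
  have h2 := M.ir₁ a b
  have h4 := (M.pay₁ (a', b)).2.1
  have h5 : (a : ℝ) < a' := hlt
  simp only [utility, h, hn, if_true, if_false] at h1 h2
  linarith

theorem Mechanism.alloc_mono₂ {a b b' : unitInterval} (h : M.alloc (a, b) = true) (hb : b ≤ b') :
    M.alloc (a, b') = true := by
  by_contra hn
  rcases hb.eq_or_lt with rfl | hlt
  · exact hn h
  have h1 := M.dsic₂ b' a b
  have h2 := M.ir₂ b a
  have h4 := (M.pay₂ (a, b')).2.1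
  have h5 : (b : ℝ) < b' := hlt
  simp only [utility, h, hn, if_true, if_false] at h1 h2
  linarith

/-- The part of the allocation region in a diagonal strip of width `e` is above a point at which
both prices are exceeded by at most `e`. -/
theorem Mechanism.exists_corner (s e : ℝ) (he : 0 ≤ e) :
    ∃ c : Profile, (∀ v : Profile, M.alloc v = true → s ≤ (v.2 : ℝ) - v.1 →
        (v.2 : ℝ) - v.1 ≤ s + e → c ≤ v) ∧
      (∀ v : Profile, M.alloc v = true → c.2 ≤ v.2 → (M.pay₁ v : ℝ) ≤ c.1 + e) ∧
      (∀ v : Profile, M.alloc v = true → c.1 ≤ v.1 → (M.pay₂ v : ℝ) ≤ c.2 + e) := by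
  set B : Set Profile := {v | M.alloc v = true} ∩
    {v | s ≤ (v.2 : ℝ) - v.1 ∧ (v.2 : ℝ) - v.1 ≤ s + e} with hB
  have hBc : IsCompact B := by
    refine (M.isClosed_region.inter ?_).isCompact
    exact (isClosed_le (f := fun _ : Profile => s) (g := fun v : Profile => (v.2 : ℝ) - v.1)
      (by fun_prop) (by fun_prop)).inter (isClosed_le (f := fun v : Profile => (v.2 : ℝ) - v.1)
      (g := fun _ : Profile => s + e) (by fun_prop) (by fun_prop))
  by_cases hne : B.Nonempty
  · obtain ⟨u, hu, humin⟩ := hBc.exists_isMinOn hne (f := fun v : Profile => v.1) (by fun_prop)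
    obtain ⟨w, hw, hwmin⟩ := hBc.exists_isMinOn hne (f := fun v : Profile => v.2) (by fun_prop)
    -- The corner combines the leftmost point `u` and the lowest point `w` of the strip and need not
    -- lie in the region. The first price is at most `w.1`, and `w.1 ≤ w.2 - s ≤ u.2 - s ≤ u.1 + e`;
    -- the second is symmetric.
    refine ⟨(u.1, w.2), fun v hv h1 h2 => ⟨humin ⟨hv, h1, h2⟩, hwmin ⟨hv, h1, h2⟩⟩, ?_, ?_⟩
    · intro v hv h
      have h1 : (M.pay₁ v : ℝ) ≤ w.1 := M.pay₁_le hv (M.alloc_mono₂ hw.1 h)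
      have h2 : (w.2 : ℝ) ≤ u.2 := hwmin hu
      have h3 := hw.2.1
      have h4 := hu.2.2
      simp only
      linarith
    · intro v hv h
      have h1 : (M.pay₂ v : ℝ) ≤ u.2 := M.pay₂_le hv (M.alloc_mono₁ hu.1 h)
      have h2 : (u.1 : ℝ) ≤ w.1 := humin hw
      have h3 := hw.2.1
      have h4 := hu.2.2
      simp only
      linarith
  -- An empty strip gets the top corner, which is harmless because payments never exceed `1`.
  · refine ⟨(1, 1), fun v hv h1 h2 => (hne ⟨v, hv, h1, h2⟩).elim, ?_, ?_⟩
    · intro v _ _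
      have := (M.pay₁ v).2.2
      simp only [Set.Icc.coe_one]
      linarith
    · intro v _ _
      have := (M.pay₂ v).2.2
      simp only [Set.Icc.coe_one]
      linarith

theorem exists_nat_lt_mem_Icc {N : ℕ} (hN : 0 < N) {x : ℝ} (h0 : 0 ≤ x) (h1 : x ≤ N) :
    ∃ k < N, (k : ℝ) ≤ x ∧ x ≤ k + 1 := by
  rcases h1.eq_or_lt with rfl | h
  -- The right endpoint belongs to the last cell, so no extra strip is needed for `v.2 - v.1 = 1`.
  · refine ⟨N - 1, by omega, ?_, ?_⟩ <;> rw [Nat.cast_pred hN] <;> linarith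
  · exact ⟨⌊x⌋₊, (Nat.floor_lt h0).2 h, Nat.floor_le h0, (Nat.lt_floor_add_one x).le⟩

/-- An excluded agent of valuation `b` would gain by reporting `v.1`. With `Mechanism.pay₁_le`, this
makes the payment the infimum of the winning bids. -/
theorem Mechanism.alloc_of_pay₁_lt {v : Profile} (hv : M.alloc v = true) {b : unitInterval}
    (hb : M.pay₁ v < b) : M.alloc (b, v.2) = true := by
  by_contra hn
  have h1 := M.dsic₁ b v.1 v.2
  have h2 := (M.pay₁ (b, v.2)).2.1
  have h3 : (M.pay₁ v : ℝ) < b := hb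
  simp only [utility, hv, hn, if_true, Prod.mk.eta, if_false] at h1
  linarith

theorem Mechanism.alloc_of_pay₂_lt {v : Profile} (hv : M.alloc v = true) {b : unitInterval}
    (hb : M.pay₂ v < b) : M.alloc (v.1, b) = true := by
  by_contra hn
  have h1 := M.dsic₂ b v.1 v.2
  have h2 := (M.pay₂ (v.1, b)).2.1
  have h3 : (M.pay₂ v : ℝ) < b := hb
  simp only [utility, hv, hn, if_true, Prod.mk.eta, if_false] at h1
  linarith

/-- Every truthful mechanism is approximated from below on its allocation region, and dominated
up to `2 / G`, by a staircase with `2 G` corners. -/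
theorem Mechanism.exists_stair (G : ℕ) (hG : 0 < G) :
    ∃ C : Fin (2 * G) → Profile, (∀ v, M.revenue v ≤ (stair C).revenue v + 2 / G) ∧
      ∀ v, M.alloc v = true → (stair C).revenue v ≤ M.revenue v := by
  classical
  have hG' : (0 : ℝ) < G := by exact_mod_cast hG
  -- The strips `k / G - 1 ≤ v.2 - v.1 ≤ (k + 1) / G - 1` with `k < 2 * G` cover the range `[-1, 1]`
  -- of the difference.
  choose C hC h1 h2 using fun k : Fin (2 * G) =>
    M.exists_corner ((k : ℝ) / G - 1) (1 / G) (by positivity)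
  have hex : ∀ v, M.alloc v = true → ∃ k, C k ≤ v := by
    intro v hv
    have hv1 := v.1.2
    have hv2 := v.2.2
    obtain ⟨k, hk, hk1, hk2⟩ := exists_nat_lt_mem_Icc (N := 2 * G) (by omega)
      (x := ((v.2 : ℝ) - v.1 + 1) * G) (mul_nonneg (by linarith [hv1.2, hv2.1]) hG'.le)
      (by push_cast; exact mul_le_mul_of_nonneg_right (by linarith [hv1.1, hv2.2]) hG'.le)
    refine ⟨⟨k, hk⟩, hC _ v hv ?_ ?_⟩
    · have := (div_le_iff₀ hG').2 hk1
      simp only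
      linarith
    · have := (le_div_iff₀ hG').2 hk2
      simp only
      rw [add_div] at this
      linarith
  refine ⟨C, fun v => ?_, fun v hv => ?_⟩
  · by_cases hv : M.alloc v = true
    · rw [stair_revenue, if_pos (hex v hv), Mechanism.revenue, if_pos hv]
      have e1 := le_price_add (x := fun k => (C k).1) (y := fun k => (C k).2) (b := v.2)
        (M.pay₁ v).2.2 (by positivity : (0 : ℝ) ≤ 1 / G) fun k hk => h1 k v hv hk
      have e2 := le_price_add (x := fun k => (C k).2) (y := fun k => (C k).1) (b := v.1)
        (M.pay₂ v).2.2 (by positivity : (0 : ℝ) ≤ 1 / G) fun k hk => h2 k v hv hk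
      have : (2 : ℝ) / G = 1 / G + 1 / G := by ring
      linarith
    · have := (stair C).revenue_nonneg v
      rw [Mechanism.revenue, if_neg hv]
      have : (0 : ℝ) ≤ 2 / G := by positivity
      linarith
  · rw [stair_revenue, if_pos (hex v hv), Mechanism.revenue, if_pos hv, one_mul]
    have e1 : price (fun k => (C k).1) (fun k => (C k).2) v.2 ≤ M.pay₁ v :=
      le_of_forall_gt_imp_ge_of_dense fun b hb => by
        obtain ⟨k, hk⟩ := hex _ (M.alloc_of_pay₁_lt hv hb)
        exact (price_le (k := k) hk.2).trans hk.1
    have e2 : price (fun k => (C k).2) (fun k => (C k).1) v.1 ≤ M.pay₂ v :=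
      le_of_forall_gt_imp_ge_of_dense fun b hb => by
        obtain ⟨k, hk⟩ := hex _ (M.alloc_of_pay₂_lt hv hb)
        exact (price_le (k := k) hk.1).trans hk.2
    exact add_le_add e1 e2

/-- The payments are not assumed measurable. Revenue is nevertheless the pointwise limit of
staircase revenues, cut off outside the closed allocation region because a staircase may allocate
more than `M` does. -/
theorem Mechanism.measurable_revenue : Measurable M.revenue := by
  classical
  choose C hC hC' using fun n : ℕ => M.exists_stair (n + 1) n.succ_pos
  refine measurable_of_tendsto_metrizable
    (f := fun n v => if M.alloc v = true then (stair (C n)).revenue v else 0)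
    (fun n => Measurable.ite M.isClosed_region.measurableSet
      (measurable_stair_revenue.comp (measurable_const.prodMk measurable_id)) measurable_const)
    (tendsto_pi_nhds.2 fun v => ?_)
  by_cases hv : M.alloc v = true
  · simp only [hv, if_true]
    have hlim : Filter.Tendsto (fun n : ℕ => M.revenue v - 2 * (1 / ((n : ℝ) + 1))) Filter.atTop
        (nhds (M.revenue v)) := by
      simpa using (tendsto_one_div_add_atTop_nhds_zero_nat (𝕜 := ℝ)).const_mul 2 |>.const_sub
        (M.revenue v)
    refine tendsto_of_tendsto_of_tendsto_of_le_of_le hlim tendsto_const_nhds (fun n => ?_)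
      fun n => hC' n v hv
    have := hC n v
    push_cast at this
    simp only
    rw [mul_one_div]
    linarith
  · simp [hv, Mechanism.revenue]

end truthful

/-! ### Exchangeability, empirical maximization and independence of samples -/

section probability

variable {α : Type*} [MeasurableSpace α]

/-- A fresh sample is the strict minimum among the samples with values above `a` with probability
at most `1 / (m + 1)`, by exchangeability. -/
theorem integral_measure_strict_min_le (μ : Measure α) [IsProbabilityMeasure μ]
    {g : α → unitInterval} (hg : Measurable g) (a : unitInterval) (m : ℕ) :
    Integrable (fun S => μ.real {v | a ≤ g v ∧ ∀ i, a ≤ g (S i) → g v < g (S i)})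
        (Measure.pi fun _ : Fin m => μ) ∧
      ∫ S, μ.real {v | a ≤ g v ∧ ∀ i, a ≤ g (S i) → g v < g (S i)}
        ∂(Measure.pi fun _ : Fin m => μ) ≤ ((m : ℝ) + 1)⁻¹ := by
  set B : Set (α × (Fin m → α)) := {q | a ≤ g q.1 ∧ ∀ i, a ≤ g (q.2 i) → g q.1 < g (q.2 i)} with hB
  have hBm : MeasurableSet B := by
    refine MeasurableSet.inter (measurableSet_le measurable_const (by fun_prop)) ?_
    have : {q : α × (Fin m → α) | ∀ i, a ≤ g (q.2 i) → g q.1 < g (q.2 i)} =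
        ⋂ i, ({q | a ≤ g (q.2 i)}ᶜ ∪ {q | g q.1 < g (q.2 i)}) := by
      ext q; simp [imp_iff_not_or]
    change MeasurableSet {q : α × (Fin m → α) | ∀ i, a ≤ g (q.2 i) → g q.1 < g (q.2 i)}
    rw [this]
    refine MeasurableSet.iInter fun i => MeasurableSet.union (MeasurableSet.compl ?_) ?_
    · exact measurableSet_le measurable_const (by fun_prop)
    · exact measurableSet_lt (by fun_prop) (by fun_prop)
  set ν := Measure.pi fun _ : Fin (m + 1) => μ
  have hmp := fun j => measurePreserving_piFinSuccAbove (fun _ : Fin (m + 1) => μ) j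
  -- `E j` says that, of `m + 1` i.i.d. samples, the `j`-th is the strict minimum among those with
  -- value at least `a`. These events are equally likely and, by strictness, disjoint.
  set E : Fin (m + 1) → Set (Fin (m + 1) → α) := fun j =>
    MeasurableEquiv.piFinSuccAbove (fun _ => α) j ⁻¹' B with hE
  have hEv : ∀ j, ν (E j) = (μ.prod (Measure.pi fun _ : Fin m => μ)) B := fun j =>
    (hmp j).measure_preimage hBm.nullMeasurableSet
  have hEm : ∀ j, MeasurableSet (E j) := fun j => (MeasurableEquiv.measurable _) hBm
  have hdisj : Pairwise (Function.onFun Disjoint E) := by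
    intro i j hij
    refine Set.disjoint_left.2 fun w hi hj => ?_
    obtain ⟨k, hk⟩ := Fin.exists_succAbove_eq hij
    obtain ⟨l, hl⟩ := Fin.exists_succAbove_eq hij.symm
    have h1 := hi.2 l
    have h2 := hj.2 k
    simp only [MeasurableEquiv.piFinSuccAbove, Fin.insertNthEquiv, MeasurableEquiv.coe_mk,
      Equiv.symm, Equiv.coe_fn_mk, Fin.removeNth] at h1 h2
    rw [hl] at h1
    rw [hk] at h2
    exact lt_asymm (h1 hj.1) (h2 hi.1)
  have hsum : ((m : ENNReal) + 1) * (μ.prod (Measure.pi fun _ : Fin m => μ)) B ≤ 1 := by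
    calc ((m : ENNReal) + 1) * (μ.prod (Measure.pi fun _ : Fin m => μ)) B
        = ∑ j, ν (E j) := by simp [hEv]
      _ = ν (⋃ j, E j) := by rw [measure_iUnion hdisj hEm, tsum_fintype]
      _ ≤ 1 := prob_le_one
  rw [Measure.prod_apply_symm hBm] at hsum
  rw [mul_comm, ← ENNReal.le_inv_iff_mul_le] at hsum
  have hmeas : Measurable fun S : Fin m → α => μ ((fun x => (x, S)) ⁻¹' B) :=
    measurable_measure_prodMk_right hBm
  refine ⟨Integrable.of_mem_Icc 0 1 hmeas.ennreal_toReal.aemeasurable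
    (ae_of_all _ fun S => ⟨measureReal_nonneg, measureReal_le_one⟩), ?_⟩
  change ∫ S, (μ ((fun x => (x, S)) ⁻¹' B)).toReal ∂(Measure.pi fun _ : Fin m => μ) ≤ _
  rw [integral_toReal hmeas.aemeasurable (ae_of_all _ fun S => measure_lt_top _ _)]
  refine (ENNReal.toReal_mono (by simp) hsum).trans_eq ?_
  rw [ENNReal.toReal_inv]
  norm_cast

/-- Inserting the candidates one at a time breaks ties by a measurable comparison; the learning
algorithm needs a measurable selection. -/
theorem exists_measurable_argmax {I Ω : Type*} [Fintype I] [Nonempty I] [MeasurableSpace I]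
    [MeasurableSingletonClass I] [MeasurableSpace Ω] (f : I → Ω → ℝ) (hf : ∀ i, Measurable (f i)) :
    ∃ g : Ω → I, Measurable g ∧ ∀ i ω, f i ω ≤ f (g ω) ω := by
  classical
  suffices h : ∀ s : Finset I, ∃ g : Ω → I, Measurable g ∧ ∀ i ∈ s, ∀ ω, f i ω ≤ f (g ω) ω by
    obtain ⟨g, hg, h⟩ := h Finset.univ
    exact ⟨g, hg, fun i => h i (Finset.mem_univ i)⟩
  intro s
  induction s using Finset.induction_on with
  | empty => exact ⟨fun _ => Classical.arbitrary I, measurable_const, by simp⟩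
  | insert j s _ ih =>
    obtain ⟨g, hg, h⟩ := ih
    have hfg : Measurable fun ω => f (g ω) ω := by
      have : Measurable fun q : Ω × I => f q.2 q.1 := measurable_from_prod_countable_left hf
      exact this.comp (measurable_id.prodMk hg)
    refine ⟨fun ω => if f (g ω) ω ≤ f j ω then j else g ω,
      Measurable.ite (measurableSet_le hfg (hf j)) measurable_const hg, fun i hi ω => ?_⟩
    simp only
    rcases Finset.mem_insert.1 hi with rfl | hi
    · split_ifs with h1
      · exact le_rfl
      · exact (not_le.1 h1).le
    · split_ifs with h1
      · exact (h i hi ω).trans h1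
      · exact h i hi ω

theorem integrable_of_mem_Icc_zero_two {Ω : Type*} [MeasurableSpace Ω] {P : Measure Ω}
    [IsFiniteMeasure P] {f : Ω → ℝ} (hf : Measurable f) (h : ∀ ω, f ω ∈ Set.Icc (0 : ℝ) 2) :
    Integrable f P :=
  Integrable.of_mem_Icc 0 2 hf.aemeasurable (ae_of_all _ h)

/-- Hoeffding's lemma: a variable with values in an interval of length `2` has variance proxy `1`,
and independence multiplies the exponential moments. -/
theorem integral_exp_sum_le (μ : Measure α) [IsProbabilityMeasure μ] {f : α → ℝ}
    (hf : Measurable f) (h : ∀ v, f v ∈ Set.Icc (0 : ℝ) 2) (n : ℕ) (s : ℝ) :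
    ∫ S : Fin n → α, Real.exp (s * ∑ j, (f (S j) - ∫ v, f v ∂μ)) ∂(Measure.pi fun _ => μ) ≤
      Real.exp (n * (s ^ 2 / 2)) := by
  have h1 := (ProbabilityTheory.hasSubgaussianMGF_of_mem_Icc hf.aemeasurable
    (ae_of_all μ h)).mgf_le s
  simp only [ProbabilityTheory.mgf] at h1
  simp_rw [Finset.mul_sum, Real.exp_sum]
  rw [integral_fintype_prod_eq_pow (μ := μ) (fun v => Real.exp (s * (f v - ∫ v, f v ∂μ))),
    Fintype.card_fin, Real.exp_nat_mul]
  refine pow_le_pow_left₀ (integral_nonneg fun _ => (Real.exp_pos _).le) (h1.trans_eq ?_) n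
  congr 1
  simp

/-- The expected value of an empirical maximizer over a finite class of `[0,2]`-valued functions. -/
theorem integral_le_integral_argmax_add (μ : Measure α) [IsProbabilityMeasure μ] {I : Type*}
    [Fintype I] [MeasurableSpace I] [MeasurableSingletonClass I] {f : I → α → ℝ}
    (hf : ∀ i, Measurable (f i)) (h : ∀ i v, f i v ∈ Set.Icc (0 : ℝ) 2) {n : ℕ} (hn : 0 < n)
    {g : (Fin n → α) → I} (hg : Measurable g)
    (hmax : ∀ i S, ∑ j, f i (S j) ≤ ∑ j, f (g S) (S j)) {s : ℝ} (hs : 0 < s) (i : I) :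
    ∫ v, f i v ∂μ ≤ (∫ S, ∫ v, f (g S) v ∂μ ∂(Measure.pi fun _ => μ)) +
      (Real.log (Fintype.card I) / (n * s) + s / 2) := by
  set P := Measure.pi fun _ : Fin n => μ
  set R : I → ℝ := fun i => ∫ v, f i v ∂μ with hR
  have hn' : (0 : ℝ) < n := by exact_mod_cast hn
  have hRm : ∀ i, R i ∈ Set.Icc (0 : ℝ) 2 := fun i =>
    ⟨integral_nonneg fun v => (h i v).1, by
      simpa using integral_mono (μ := μ) (integrable_of_mem_Icc_zero_two (hf i) (h i))
        (integrable_const (2 : ℝ)) fun v => (h i v).2⟩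
  have hcard : (0 : ℝ) < Fintype.card I := by
    exact_mod_cast Fintype.card_pos_iff.2 ⟨i⟩
  -- `c` bounds the expected sum over all of `I` of the exponential moments, which is the union
  -- bound.
  set c : ℝ := Fintype.card I * Real.exp (n * (s ^ 2 / 2)) with hc
  have hc0 : 0 < c := by positivity
  have hRg : Measurable fun S => R (g S) := (measurable_of_countable R).comp hg
  have hRgi : Integrable (fun S => R (g S)) P :=
    integrable_of_mem_Icc_zero_two hRg fun S => hRm _
  have hexpi : ∀ k, Integrable (fun S : Fin n → α =>
      Real.exp (s * ∑ j, (f k (S j) - R k))) P := by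
    intro k
    refine Integrable.of_mem_Icc 0 (Real.exp (s * (n * 2))) ?_ (ae_of_all _ fun S =>
      ⟨(Real.exp_pos _).le, Real.exp_le_exp.2 (mul_le_mul_of_nonneg_left ?_ hs.le)⟩)
    · have := hf k
      exact Measurable.aemeasurable (by fun_prop)
    · calc ∑ j, (f k (S j) - R k) ≤ ∑ _j : Fin n, (2 : ℝ) :=
            Finset.sum_le_sum fun j _ => by linarith [(h k (S j)).2, (hRm k).1]
        _ = n * 2 := by simp
  have hpt : ∀ S, ∑ j, f i (S j) ≤ n * R (g S) +
      (Real.log c - 1 + ∑ k, Real.exp (s * ∑ j, (f k (S j) - R k)) / c) / s := by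
    intro S
    refine (hmax i S).trans ?_
    have h1 : ∑ j, f (g S) (S j) = n * R (g S) + ∑ j, (f (g S) (S j) - R (g S)) := by
      simp
    rw [h1]
    gcongr
    rw [le_div_iff₀ hs]
    set X := ∑ j, (f (g S) (S j) - R (g S)) with hX
    -- The tangent inequality `x ≤ log c - 1 + exp x / c` replaces Jensen's inequality for the
    -- logarithm. The data-dependent index `g S` is then removed by summing over all indices.
    have h2 := Real.add_one_le_exp (s * X - Real.log c)
    rw [Real.exp_sub, Real.exp_log hc0] at h2
    have h3 : Real.exp (s * X) / c ≤ ∑ k, Real.exp (s * ∑ j, (f k (S j) - R k)) / c :=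
      Finset.single_le_sum (f := fun k => Real.exp (s * ∑ j, (f k (S j) - R k)) / c)
        (fun k _ => by positivity) (Finset.mem_univ (g S))
    linarith
  have hfi : ∀ j : Fin n, Integrable (fun S : Fin n → α => f i (S j)) P := fun j =>
    integrable_of_mem_Icc_zero_two ((hf i).comp (measurable_pi_apply j)) fun S => h i (S j)
  have hL : ∫ S, ∑ j, f i (S j) ∂P = n * R i := by
    rw [integral_finsetSum _ fun j _ => hfi j]
    have : ∀ j : Fin n, ∫ S, f i (S j) ∂P = R i := fun j => by
      have hmp := measurePreserving_eval (fun _ : Fin n => μ) j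
      rw [hR, ← hmp.map_eq]
      exact (integral_map hmp.measurable.aemeasurable (hf i).aestronglyMeasurable).symm
    simp [this]
  have hsumi : Integrable (fun S => ∑ k, Real.exp (s * ∑ j, (f k (S j) - R k)) / c) P :=
    integrable_finsetSum _ fun k _ => (hexpi k).div_const c
  have hdev : Integrable (fun S =>
      (Real.log c - 1 + ∑ k, Real.exp (s * ∑ j, (f k (S j) - R k)) / c) / s) P :=
    ((integrable_const _).add hsumi).div_const s
  have hI := integral_mono (μ := P) (integrable_finsetSum _ fun j _ => hfi j)
    ((hRgi.const_mul _).add hdev) hpt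
  rw [hL] at hI
  simp only [Pi.add_apply] at hI
  rw [integral_add (hRgi.const_mul _) hdev, integral_const_mul, integral_div,
    integral_add (integrable_const _) hsumi, integral_finsetSum _ fun k _ =>
    (hexpi k).div_const c] at hI
  have hle : ∑ k, ∫ S, Real.exp (s * ∑ j, (f k (S j) - R k)) / c ∂P ≤ 1 := by
    calc _ ≤ ∑ _k : I, Real.exp (n * (s ^ 2 / 2)) / c := Finset.sum_le_sum fun k _ => by
          rw [integral_div]
          gcongr
          exact integral_exp_sum_le μ (hf k) (h k) n s
      _ = 1 := by
          rw [Finset.sum_const, Finset.card_univ, nsmul_eq_mul, ← mul_div_assoc, div_self hc0.ne']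
  have hlog : Real.log c = Real.log (Fintype.card I) + n * (s ^ 2 / 2) := by
    rw [hc, Real.log_mul hcard.ne' (Real.exp_pos _).ne', Real.log_exp]
  have hI' : n * R i ≤ n * (∫ S, R (g S) ∂P) + Real.log c / s := by
    refine hI.trans ?_
    gcongr
    simp only [integral_const, probReal_univ, one_smul]
    linarith
  have : Real.log c / s = n * (Real.log (Fintype.card I) / (n * s) + s / 2) := by
    rw [hlog]
    field_simp
  rw [this, ← mul_add] at hI'
  exact le_of_mul_le_mul_left hI' hn'

theorem measurePreserving_comp_injective {ι ι' : Type*} [Fintype ι] [Fintype ι']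
    (μ : Measure α) [IsProbabilityMeasure μ] {g : ι' → ι} (hg : Function.Injective g) :
    MeasurePreserving (fun (v : ι → α) i => v (g i)) (Measure.pi fun _ => μ)
      (Measure.pi fun _ => μ) := by
  classical
  refine ⟨by fun_prop, (Measure.pi_eq fun s hs => ?_).symm⟩
  rw [Measure.map_apply (by fun_prop) (MeasurableSet.univ_pi hs)]
  -- By injectivity each intersection involves at most one `s i`; a coordinate outside the range of
  -- `g` is unconstrained and contributes a factor `1`.
  have : (fun (v : ι → α) i => v (g i)) ⁻¹' Set.univ.pi s =
      Set.univ.pi fun k => ⋂ (i) (_ : g i = k), s i := by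
    ext v
    simp [@forall_comm ι]
  rw [this, Measure.pi_pi, ← Finset.prod_subset (Finset.subset_univ (Finset.univ.image g)),
    Finset.prod_image fun _ _ _ _ h => hg h]
  · refine Finset.prod_congr rfl fun i _ => ?_
    congr 1
    ext x
    simp [hg.eq_iff]
  · intro k _ hk
    have : ∀ i, g i ≠ k := fun i hi => hk (Finset.mem_image.2 ⟨i, Finset.mem_univ i, hi⟩)
    simp [this]

/-- The two exploration samples and the current valuation occupy distinct rounds, hence are jointly
independent; regret in a commit round becomes an integral over a product measure. -/
theorem measurePreserving_samples {ι κ κ' : Type*} [Fintype ι] [Fintype κ] [Fintype κ']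
    (μ : Measure α) [IsProbabilityMeasure μ] {g : κ → ι} {g' : κ' → ι} {t : ι}
    (hg : Function.Injective (Sum.elim (Sum.elim g g') fun _ : Unit => t)) :
    MeasurePreserving (fun v : ι → α => (((fun i => v (g i)), (fun i => v (g' i))), v t))
      (Measure.pi fun _ => μ)
      (((Measure.pi fun _ => μ).prod (Measure.pi fun _ => μ)).prod μ) := by
  have h1 := measurePreserving_comp_injective μ hg
  have h2 := measurePreserving_sumPiEquivProdPi (fun _ : (κ ⊕ κ') ⊕ Unit => μ)
  have h3 := measurePreserving_sumPiEquivProdPi (fun _ : κ ⊕ κ' => μ)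
  have h4 := measurePreserving_eval (fun _ : Unit => μ) ()
  exact (h3.prod h4).comp (h2.comp h1)

end probability

/-! ### Staircases with sampled corners and their generalization -/

/-- Indices of the staircases whose corners have coordinates among those of `m` samples, or `1`. -/
def CornerIndex (K m : ℕ) : Type := Fin K → Option (Fin m) × Option (Fin m)

namespace CornerIndex

variable {K m : ℕ}

instance : Fintype (CornerIndex K m) := inferInstanceAs (Fintype (Fin K → _))

instance : Nonempty (CornerIndex K m) := inferInstanceAs (Nonempty (Fin K → _))

instance : MeasurableSpace (CornerIndex K m) := ⊤

instance : MeasurableSingletonClass (CornerIndex K m) := ⟨fun _ => trivial⟩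

theorem card : Fintype.card (CornerIndex K m) = (m + 1) ^ (2 * K) := by
  have : Fintype.card (CornerIndex K m) =
      Fintype.card (Fin K → Option (Fin m) × Option (Fin m)) := rfl
  rw [this]
  simp [pow_mul, sq]

/-- The corners with the given index. -/
def corner (i : CornerIndex K m) (S : Fin m → Profile) (k : Fin K) : Profile :=
  ((i k).1.elim 1 fun j => (S j).1, (i k).2.elim 1 fun j => (S j).2)

theorem measurable_corner (i : CornerIndex K m) : Measurable i.corner := by
  refine measurable_pi_lambda _ fun k => Measurable.prodMk ?_ ?_
  · cases (i k).1 with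
    | none => exact measurable_const
    | some j => exact measurable_fst.comp (measurable_pi_apply j)
  · cases (i k).2 with
    | none => exact measurable_const
    | some j => exact measurable_snd.comp (measurable_pi_apply j)

/-- The revenue of the indexed staircase. -/
def revenue (i : CornerIndex K m) (S : Fin m → Profile) (v : Profile) : ℝ :=
  (stair (i.corner S)).revenue v

theorem measurable_revenue (i : CornerIndex K m) :
    Measurable fun q : (Fin m → Profile) × Profile => i.revenue q.1 q.2 :=
  measurable_stair_revenue.comp (f := fun q : (Fin m → Profile) × Profile => (i.corner q.1, q.2))
    ((i.measurable_corner.comp measurable_fst).prodMk measurable_snd)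

theorem revenue_mem (i : CornerIndex K m) (S : Fin m → Profile) (v : Profile) :
    i.revenue S v ∈ Set.Icc (0 : ℝ) 2 :=
  ⟨Mechanism.revenue_nonneg _ _, Mechanism.revenue_le_two _ _⟩

end CornerIndex

theorem exists_roundUp {m : ℕ} (x : Fin m → unitInterval) (a : unitInterval) :
    ∃ o : Option (Fin m), a ≤ o.elim 1 x ∧ ∀ i, a ≤ x i → o.elim 1 x ≤ x i := by
  classical
  by_cases h : ({i | a ≤ x i} : Set (Fin m)).Nonempty
  · obtain ⟨i, hi, hmin⟩ := Set.exists_min_image _ x (Set.toFinite _) h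
    exact ⟨some i, hi, fun j hj => hmin j hj⟩
  · exact ⟨none, unitInterval.le_one', fun i hi => (h ⟨i, hi⟩).elim⟩

/-- The valuations at which the constraint `a ≤ g v` is lost when `a` is rounded up to the next
sample. -/
def gap {m : ℕ} (g : Profile → unitInterval) (a : unitInterval) (S : Fin m → Profile) :
    Set Profile :=
  {v | a ≤ g v ∧ ∀ i, a ≤ g (S i) → g v < g (S i)}

theorem measurableSet_gap {m : ℕ} {g : Profile → unitInterval} (hg : Measurable g)
    (a : unitInterval) (S : Fin m → Profile) : MeasurableSet (gap g a S) := by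
  have : gap g a S = {v | a ≤ g v} ∩ ⋂ (i) (_ : a ≤ g (S i)), {v | g v < g (S i)} := by
    ext v; simp [gap]
  rw [this]
  exact (measurableSet_le measurable_const hg).inter <| MeasurableSet.iInter fun i =>
    MeasurableSet.iInter fun _ => measurableSet_lt hg measurable_const

/-- Each coordinate is rounded up to the least sample above it, or to `1`. Prices only rise, so
revenue can drop only where some corner below `v` ceases to be below it; then `v` lies in a gap, and
the drop is at most `2`. -/
theorem exists_cornerIndex {K m : ℕ} (C : Fin K → Profile) (S : Fin m → Profile) :
    ∃ i : CornerIndex K m, ∀ v, (stair C).revenue v ≤ i.revenue S v +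
      2 * ∑ k, ((gap Prod.fst (C k).1 S).indicator (fun _ => (1 : ℝ)) v +
        (gap Prod.snd (C k).2 S).indicator (fun _ => (1 : ℝ)) v) := by
  classical
  choose o ho1 ho2 using fun k => exists_roundUp (fun j => (S j).1) (C k).1
  choose o' ho1' ho2' using fun k => exists_roundUp (fun j => (S j).2) (C k).2
  refine ⟨fun k => (o k, o' k), fun v => ?_⟩
  have hnn : ∀ k, 0 ≤ (gap Prod.fst (C k).1 S).indicator (fun _ => (1 : ℝ)) v +
      (gap Prod.snd (C k).2 S).indicator (fun _ => (1 : ℝ)) v := fun k =>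
    add_nonneg (Set.indicator_nonneg (fun _ _ => zero_le_one) _)
      (Set.indicator_nonneg (fun _ _ => zero_le_one) _)
  by_cases hb : ∀ k, C k ≤ v → CornerIndex.corner (fun k => (o k, o' k)) S k ≤ v
  · exact (stair_revenue_le (fun k => ⟨ho1 k, ho1' k⟩) hb).trans
      (le_add_of_nonneg_right (mul_nonneg zero_le_two (Finset.sum_nonneg fun k _ => hnn k)))
  · push Not at hb
    obtain ⟨k, hk, hk'⟩ := hb
    have h1 : (1 : ℝ) ≤ ∑ k, ((gap Prod.fst (C k).1 S).indicator (fun _ => (1 : ℝ)) v +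
        (gap Prod.snd (C k).2 S).indicator (fun _ => (1 : ℝ)) v) := by
      refine le_trans ?_ (Finset.single_le_sum (fun k _ => hnn k) (Finset.mem_univ k))
      have : v ∈ gap Prod.fst (C k).1 S ∨ v ∈ gap Prod.snd (C k).2 S := by
        by_contra hn
        push Not at hn
        refine hk' ⟨?_, ?_⟩
        · by_contra hlt
          exact hn.1 ⟨hk.1, fun i hi => (not_le.1 hlt).trans_le (ho2 k i hi)⟩
        · by_contra hlt
          exact hn.2 ⟨hk.2, fun i hi => (not_le.1 hlt).trans_le (ho2' k i hi)⟩
      rcases this with h | h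
      · rw [Set.indicator_of_mem h]
        exact le_add_of_nonneg_right (Set.indicator_nonneg (fun _ _ => zero_le_one) _)
      · rw [Set.indicator_of_mem h]
        exact le_add_of_nonneg_left (Set.indicator_nonneg (fun _ _ => zero_le_one) _)
    have h2 := Mechanism.revenue_le_two (stair C) v
    have h3 := (CornerIndex.revenue_mem (fun k => (o k, o' k)) S v).1
    linarith

theorem exists_empirical_maximizer (K m : ℕ) :
    ∃ e : (Fin m → Profile) × (Fin m → Profile) → CornerIndex K m, Measurable e ∧
      ∀ (i : CornerIndex K m) q, ∑ j, i.revenue q.1 (q.2 j) ≤ ∑ j, (e q).revenue q.1 (q.2 j) :=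
  exists_measurable_argmax
    (fun (i : CornerIndex K m) (q : (Fin m → Profile) × (Fin m → Profile)) =>
      ∑ j, i.revenue q.1 (q.2 j))
    fun i => Finset.measurable_sum _ fun j _ => i.measurable_revenue.comp
      (f := fun q : (Fin m → Profile) × (Fin m → Profile) => (q.1, q.2 j)) (by fun_prop)

theorem measurable_revenue_comp {K m : ℕ} {Ω : Type*} [MeasurableSpace Ω]
    {e : Ω → CornerIndex K m} (he : Measurable e) {f : Ω → Fin m → Profile} (hf : Measurable f)
    {w : Ω → Profile} (hw : Measurable w) : Measurable fun q => (e q).revenue (f q) (w q) := by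
  have : Measurable fun p : ((Fin m → Profile) × Profile) × CornerIndex K m =>
      p.2.revenue p.1.1 p.1.2 :=
    measurable_from_prod_countable_left fun i => i.measurable_revenue
  exact this.comp ((hf.prodMk hw).prodMk he)

/-- The expected revenue of the empirical maximizer is close to that of any staircase. -/
theorem integral_stair_le (μ : Measure Profile) [IsProbabilityMeasure μ] {K m : ℕ} (hm : 0 < m)
    {e : (Fin m → Profile) × (Fin m → Profile) → CornerIndex K m} (he : Measurable e)
    (hmax : ∀ (i : CornerIndex K m) q, ∑ j, i.revenue q.1 (q.2 j) ≤ ∑ j, (e q).revenue q.1 (q.2 j))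
    {s : ℝ} (hs : 0 < s) (C : Fin K → Profile) :
    ∫ v, (stair C).revenue v ∂μ ≤
      (∫ q, (e q.1).revenue q.1.1 q.2
        ∂(((Measure.pi fun _ => μ).prod (Measure.pi fun _ => μ)).prod μ)) +
      (4 * K / (m + 1) + (Real.log ((m + 1 : ℝ) ^ (2 * K)) / (m * s) + s / 2)) := by
  set P := Measure.pi fun _ : Fin m => μ
  have hrev : ∀ (i : CornerIndex K m) S, Measurable (i.revenue S) := fun i S =>
    i.measurable_revenue.comp (measurable_const.prodMk measurable_id)
  have hjoint : Measurable fun q : ((Fin m → Profile) × (Fin m → Profile)) × Profile =>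
      (e q.1).revenue q.1.1 q.2 :=
    measurable_revenue_comp (he.comp measurable_fst) (by fun_prop) (by fun_prop)
  have hint : Integrable (fun q : ((Fin m → Profile) × (Fin m → Profile)) × Profile =>
      (e q.1).revenue q.1.1 q.2) ((P.prod P).prod μ) :=
    integrable_of_mem_Icc_zero_two hjoint fun q => CornerIndex.revenue_mem _ _ _
  have hind : ∀ (g : Profile → unitInterval), Measurable g → ∀ a (S : Fin m → Profile),
      Integrable ((gap g a S).indicator fun _ => (1 : ℝ)) μ := fun g hg a S =>
    (integrable_const _).indicator (measurableSet_gap hg a S)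
  set dev := Real.log ((m + 1 : ℝ) ^ (2 * K)) / (m * s) + s / 2
  -- With `S` fixed the candidate class is a fixed finite one and `S'` is a fresh sample, so the
  -- finite-class bound applies. Reusing `S` for the selection would break this independence.
  have hS : ∀ S : Fin m → Profile, ∫ v, (stair C).revenue v ∂μ ≤
      (∫ S', ∫ v, (e (S, S')).revenue S v ∂μ ∂P) + (dev +
        2 * ∑ k, (μ.real (gap Prod.fst (C k).1 S) + μ.real (gap Prod.snd (C k).2 S))) := by
    intro S
    obtain ⟨i, hi⟩ := exists_cornerIndex C S
    have h1 := integral_le_integral_argmax_add μ (fun i => hrev i S)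
      (fun i v => i.revenue_mem S v) hm (he.comp (measurable_const.prodMk measurable_id))
      (fun i S' => hmax i (S, S')) hs i
    rw [CornerIndex.card] at h1
    push_cast at h1
    have hsum : Integrable (fun v => ∑ k, ((gap Prod.fst (C k).1 S).indicator (fun _ => (1 : ℝ)) v +
        (gap Prod.snd (C k).2 S).indicator (fun _ => (1 : ℝ)) v)) μ :=
      integrable_finsetSum _ fun k _ =>
        (hind _ measurable_fst _ _).add (hind _ measurable_snd _ _)
    have hirev : Integrable (i.revenue S) μ :=
      integrable_of_mem_Icc_zero_two (hrev i S) (i.revenue_mem S)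
    have h2 := integral_mono (μ := μ)
      (integrable_of_mem_Icc_zero_two (stair C).measurable_revenue fun v =>
        ⟨Mechanism.revenue_nonneg _ _, Mechanism.revenue_le_two _ _⟩)
      (hirev.add (hsum.const_mul 2)) hi
    simp only [Pi.add_apply] at h2
    have hki : ∀ k, Integrable (fun v => (gap Prod.fst (C k).1 S).indicator (fun _ => (1 : ℝ)) v +
        (gap Prod.snd (C k).2 S).indicator (fun _ => (1 : ℝ)) v) μ := fun k =>
      (hind _ measurable_fst _ _).add (hind _ measurable_snd _ _)
    rw [integral_add hirev (hsum.const_mul 2), integral_const_mul,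
      integral_finsetSum _ fun k _ => hki k] at h2
    have h3 : ∀ k, ∫ v, ((gap Prod.fst (C k).1 S).indicator (fun _ => (1 : ℝ)) v +
        (gap Prod.snd (C k).2 S).indicator (fun _ => (1 : ℝ)) v) ∂μ =
        μ.real (gap Prod.fst (C k).1 S) + μ.real (gap Prod.snd (C k).2 S) := by
      intro k
      rw [integral_add (hind _ measurable_fst _ _) (hind _ measurable_snd _ _),
        integral_indicator_const _ (measurableSet_gap measurable_fst _ _),
        integral_indicator_const _ (measurableSet_gap measurable_snd _ _)]
      simp
    simp_rw [h3] at h2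
    simp only [Function.comp_def, id] at h1
    change ∫ v, i.revenue S v ∂μ ≤ _ + dev at h1
    linarith
  have hgap : ∀ (g : Profile → unitInterval), Measurable g → ∀ a,
      Integrable (fun S : Fin m → Profile => μ.real (gap g a S)) P ∧
        ∫ S, μ.real (gap g a S) ∂P ≤ ((m : ℝ) + 1)⁻¹ := fun g hg a =>
    integral_measure_strict_min_le μ hg a m
  have hgap₁ := fun k => hgap _ measurable_fst (C k).1
  have hgap₂ := fun k => hgap _ measurable_snd (C k).2
  have hgi : ∀ k, Integrable (fun S : Fin m → Profile =>
      μ.real (gap Prod.fst (C k).1 S) + μ.real (gap Prod.snd (C k).2 S)) P := fun k =>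
    (hgap₁ k).1.add (hgap₂ k).1
  have hgs : Integrable (fun S : Fin m → Profile =>
      ∑ k, (μ.real (gap Prod.fst (C k).1 S) + μ.real (gap Prod.snd (C k).2 S))) P :=
    integrable_finsetSum _ fun k _ => hgi k
  have hA := hint.integral_prod_left
  have hA' : Integrable (fun S => ∫ S', ∫ v, (e (S, S')).revenue S v ∂μ ∂P) P :=
    hA.integral_prod_left
  have hB : Integrable (fun S => dev +
      2 * ∑ k, (μ.real (gap Prod.fst (C k).1 S) + μ.real (gap Prod.snd (C k).2 S))) P :=
    (integrable_const dev).add (hgs.const_mul 2)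
  have hq : ∫ q, (e q.1).revenue q.1.1 q.2 ∂((P.prod P).prod μ) =
      ∫ S, ∫ S', ∫ v, (e (S, S')).revenue S v ∂μ ∂P ∂P := by
    rw [integral_prod _ hint, integral_prod _ hA]
  have hI := integral_mono (μ := P) (integrable_const _) (hA'.add hB) hS
  simp only [Pi.add_apply] at hI
  rw [integral_add hA' hB, integral_add (integrable_const dev) (hgs.const_mul 2),
    integral_const_mul, integral_finsetSum _ fun k _ => hgi k, ← hq] at hI
  -- There are two gaps per corner, each of expected mass at most `1 / (m + 1)`; the possible loss
  -- of `2` then gives `4 * K / (m + 1)`.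
  have hle : ∑ k, ∫ S, (μ.real (gap Prod.fst (C k).1 S) + μ.real (gap Prod.snd (C k).2 S)) ∂P ≤
      K * (2 * ((m : ℝ) + 1)⁻¹) := by
    calc _ ≤ ∑ _k : Fin K, 2 * ((m : ℝ) + 1)⁻¹ := Finset.sum_le_sum fun k _ => by
          rw [integral_add (hgap₁ k).1 (hgap₂ k).1, two_mul]
          exact add_le_add (hgap₁ k).2 (hgap₂ k).2
      _ = _ := by simp
  simp only [integral_const, probReal_univ, one_smul] at hI
  have : (4 : ℝ) * K / (m + 1) = 2 * (K * (2 * ((m : ℝ) + 1)⁻¹)) := by ring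
  linarith

/-! ### The explore-then-commit algorithm and its regret -/

/-- The first `m` of `t` samples and the next `m` ones. -/
def splitSamples {m t : ℕ} (h : 2 * m ≤ t) (q : Fin t → Profile) :
    (Fin m → Profile) × (Fin m → Profile) :=
  (fun i => q ⟨i, by omega⟩, fun i => q ⟨m + i, by omega⟩)

theorem measurable_splitSamples {m t : ℕ} (h : 2 * m ≤ t) : Measurable (splitSamples h) := by
  unfold splitSamples
  fun_prop

/-- Post a fixed mechanism for `2 m` rounds, then the indexed staircase chosen by `e`. -/
def exploreThenCommit (T : ℕ) {K m : ℕ}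
    {e : (Fin m → Profile) × (Fin m → Profile) → CornerIndex K m} (he : Measurable e) :
    LearningAlgorithm T where
  choose t q := if h : 2 * m ≤ t then
    stair ((e (splitSamples h q)).corner (splitSamples h q).1) else stair fun _ : Unit => 1
  measurable_revenue t := by
    by_cases h : 2 * m ≤ t
    · simp only [h, dif_pos]
      exact measurable_revenue_comp (he.comp ((measurable_splitSamples h).comp measurable_fst))
        ((measurable_fst.comp (measurable_splitSamples h)).comp measurable_fst) measurable_snd
    · simp only [h, dif_neg, not_false_eq_true]
      exact measurable_stair_revenue.comp (measurable_const.prodMk measurable_snd)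

theorem LearningAlgorithm.measurable_posted {T : ℕ} (A : LearningAlgorithm T) (t : Fin T) :
    Measurable fun v => (A.posted v t).revenue (v t) :=
  (A.measurable_revenue t).comp
    (f := fun v : Fin T → Profile => ((fun s => v (Fin.castLE t.isLt.le s)), v t)) (by fun_prop)

theorem Mechanism.integrable_revenue (M : Mechanism) {Ω : Type*} [MeasurableSpace Ω]
    {P : Measure Ω} [IsFiniteMeasure P] {w : Ω → Profile} (hw : Measurable w) :
    Integrable (fun ω => M.revenue (w ω)) P :=
  integrable_of_mem_Icc_zero_two (M.measurable_revenue.comp hw) fun _ =>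
    ⟨M.revenue_nonneg _, M.revenue_le_two _⟩

theorem LearningAlgorithm.integrable_posted {T : ℕ} (A : LearningAlgorithm T) (t : Fin T)
    (P : Measure (Fin T → Profile)) [IsFiniteMeasure P] :
    Integrable (fun v => (A.posted v t).revenue (v t)) P :=
  integrable_of_mem_Icc_zero_two (A.measurable_posted t) fun _ =>
    ⟨Mechanism.revenue_nonneg _ _, Mechanism.revenue_le_two _ _⟩

theorem LearningAlgorithm.integrable_regret {T : ℕ} (A : LearningAlgorithm T) (M : Mechanism)
    (P : Measure (Fin T → Profile)) [IsFiniteMeasure P] :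
    Integrable (fun v => ∑ t, M.revenue (v t) - ∑ t, (A.posted v t).revenue (v t)) P :=
  (integrable_finsetSum _ fun t _ => M.integrable_revenue (measurable_pi_apply t)).sub
    (integrable_finsetSum _ fun t _ => A.integrable_posted t P)

theorem LearningAlgorithm.stochasticRegret_le {T : ℕ} {A : LearningAlgorithm T} {b : ℝ}
    (h : ∀ (μ : Measure Profile) [IsProbabilityMeasure μ] (M : Mechanism),
      ∫ v : Fin T → Profile, (∑ t, M.revenue (v t) - ∑ t, (A.posted v t).revenue (v t))
        ∂(Measure.pi fun _ => μ) ≤ b) : A.stochasticRegret ≤ (b : EReal) :=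
  iSup_le fun μ => iSup_le fun M => EReal.coe_le_coe (h μ M)

theorem LearningAlgorithm.stochasticRegret_le_two_mul {T : ℕ} (A : LearningAlgorithm T) :
    A.stochasticRegret ≤ ((2 * T : ℝ) : EReal) := by
  refine LearningAlgorithm.stochasticRegret_le fun μ _ M => ?_
  refine (integral_mono (g := fun _ => (2 * T : ℝ)) (A.integrable_regret M _) (integrable_const _)
    fun v => ?_).trans_eq (by simp)
  have h1 : ∑ t, M.revenue (v t) ≤ ∑ _t : Fin T, (2 : ℝ) :=
    Finset.sum_le_sum fun t _ => M.revenue_le_two _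
  have h2 : 0 ≤ ∑ t, (A.posted v t).revenue (v t) :=
    Finset.sum_nonneg fun t _ => Mechanism.revenue_nonneg _ _
  simp only [Finset.sum_const, Finset.card_univ, Fintype.card_fin, nsmul_eq_mul] at h1
  linarith

/-- Each round pays `2 / G` for the passage to a staircase. The at most `2 * m` exploration rounds
lose at most `2` each, whatever is posted there, and every later round loses the bound of
`integral_stair_le` with `K = 2 * G`. -/
theorem exists_stochasticRegret_le (T : ℕ) {G m : ℕ} (hG : 0 < G) (hm : 0 < m) {s : ℝ}
    (hs : 0 < s) : ∃ A : LearningAlgorithm T, A.stochasticRegret ≤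
      ((T * (2 / G) + 4 * m + T * (4 * (2 * G) / (m + 1) +
        (Real.log ((m + 1 : ℝ) ^ (2 * (2 * G))) / (m * s) + s / 2)) : ℝ) : EReal) := by
  obtain ⟨e, he, hmax⟩ := exists_empirical_maximizer (2 * G) m
  refine ⟨exploreThenCommit T he, LearningAlgorithm.stochasticRegret_le fun μ _ M => ?_⟩
  obtain ⟨C, hC, -⟩ := M.exists_stair G hG
  set A := exploreThenCommit T he
  set err : ℝ := 4 * (2 * G) / (m + 1) +
    (Real.log ((m + 1 : ℝ) ^ (2 * (2 * G))) / (m * s) + s / 2)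
  have herr : 0 ≤ err := by
    have : 0 ≤ Real.log ((m + 1 : ℝ) ^ (2 * (2 * G))) :=
      Real.log_nonneg (one_le_pow₀ (by linarith [(Nat.cast_nonneg m : (0 : ℝ) ≤ m)]))
    positivity
  have hCi : ∀ t, Integrable (fun v : Fin T → Profile => (stair C).revenue (v t) + 2 / G)
      (Measure.pi fun _ => μ) := fun t =>
    ((stair C).integrable_revenue (measurable_pi_apply t)).add (integrable_const _)
  have hgi : ∀ t, Integrable (fun v : Fin T → Profile =>
      (stair C).revenue (v t) + 2 / G - (A.posted v t).revenue (v t)) (Measure.pi fun _ => μ) :=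
    fun t => (hCi t).sub (A.integrable_posted t _)
  have hround : ∀ t : Fin T, ∫ v : Fin T → Profile,
      ((stair C).revenue (v t) + 2 / G - (A.posted v t).revenue (v t)) ∂(Measure.pi fun _ => μ) ≤
      2 / G + ((if (t : ℕ) < 2 * m then 2 else 0) + err) := by
    intro t
    have h1 : ∫ v : Fin T → Profile, (stair C).revenue (v t) ∂(Measure.pi fun _ => μ) =
        ∫ v, (stair C).revenue v ∂μ := by
      have hmp := measurePreserving_eval (fun _ : Fin T => μ) t
      conv_rhs => rw [← hmp.map_eq]
      exact (integral_map hmp.measurable.aemeasurable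
        (stair C).measurable_revenue.aestronglyMeasurable).symm
    rw [integral_sub (hCi t) (A.integrable_posted t _), integral_add
      ((stair C).integrable_revenue (measurable_pi_apply t)) (integrable_const _), h1]
    simp only [integral_const, probReal_univ, one_smul]
    split_ifs with ht
    · have h2 : ∫ v, (stair C).revenue v ∂μ ≤ 2 :=
        (integral_mono ((stair C).integrable_revenue measurable_id) (integrable_const (2 : ℝ))
          (Mechanism.revenue_le_two _)).trans_eq (by simp)
      have h3 : 0 ≤ ∫ v : Fin T → Profile, (A.posted v t).revenue (v t)
          ∂(Measure.pi fun _ => μ) := integral_nonneg fun v => Mechanism.revenue_nonneg _ _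
      linarith
    · have htm : 2 * m ≤ t := not_lt.1 ht
      have h2 := integral_stair_le μ hm he hmax hs C
      have hinj : Function.Injective (Sum.elim (Sum.elim
          (fun i : Fin m => (⟨i, by omega⟩ : Fin T)) fun i : Fin m => ⟨m + i, by omega⟩)
          fun _ : Unit => t) := by
        have := t.isLt
        rintro ((i | i) | i) ((j | j) | j) hij <;>
          simp only [Sum.elim_inl, Sum.elim_inr, Fin.ext_iff] at hij <;>
          first | omega | (congr 2; apply Fin.ext; omega) | rfl
      have hmp := measurePreserving_samples μ hinj
      have h3 : ∫ v : Fin T → Profile, (A.posted v t).revenue (v t) ∂(Measure.pi fun _ => μ) =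
          ∫ q, (e q.1).revenue q.1.1 q.2
            ∂(((Measure.pi fun _ => μ).prod (Measure.pi fun _ => μ)).prod μ) := by
        have hjoint : Measurable fun q : ((Fin m → Profile) × (Fin m → Profile)) × Profile =>
            (e q.1).revenue q.1.1 q.2 :=
          measurable_revenue_comp (he.comp measurable_fst) (by fun_prop) (by fun_prop)
        rw [← hmp.map_eq,
          integral_map hmp.measurable.aemeasurable hjoint.aestronglyMeasurable]
        refine integral_congr_ae (ae_of_all _ fun v => ?_)
        simp only [A, LearningAlgorithm.posted, exploreThenCommit, dif_pos htm,
          CornerIndex.revenue, splitSamples]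
        rfl
      rw [h3]
      push_cast at h2
      change _ ≤ _ + err at h2
      linarith
  refine (integral_mono (g := fun v => ∑ t,
    ((stair C).revenue (v t) + 2 / G - (A.posted v t).revenue (v t))) (A.integrable_regret M _)
    (integrable_finsetSum _ fun t _ => hgi t) fun v => ?_).trans ?_
  · simp only [← Finset.sum_sub_distrib]
    exact Finset.sum_le_sum fun t _ => sub_le_sub_right (hC (v t)) _
  · rw [integral_finsetSum _ fun t _ => hgi t]
    refine (Finset.sum_le_sum fun t _ => hround t).trans ?_
    have hcount : ∑ t : Fin T, (if (t : ℕ) < 2 * m then (2 : ℝ) else 0) ≤ 4 * m := by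
      rw [Fin.sum_univ_eq_sum_range (fun t => if t < 2 * m then (2 : ℝ) else 0) T,
        ← Finset.sum_filter, Finset.sum_const, nsmul_eq_mul]
      have : ((Finset.range T).filter (· < 2 * m)).card ≤ 2 * m := by
        refine (Finset.card_le_card (t := Finset.range (2 * m)) fun x hx => ?_).trans_eq
          (Finset.card_range _)
        exact Finset.mem_range.2 (Finset.mem_filter.1 hx).2
      have : (((Finset.range T).filter (· < 2 * m)).card : ℝ) ≤ 2 * m := by exact_mod_cast this
      linarith
    rw [Finset.sum_add_distrib, Finset.sum_add_distrib]
    simp only [Finset.sum_const, Finset.card_univ, Fintype.card_fin, nsmul_eq_mul]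
    linarith

/-! ### Tuning of the parameters -/

/-- The choice of parameters: `m ≈ T d`, `G ≈ 1 / d` and `s = 2 d`. -/
theorem exists_stochasticRegret_le_of_pow {T : ℕ} (hT : 2 ≤ T) {d : ℝ} (hd : 0 < d)
    (hd2 : d < 2 / 35) (hdT : T * d ^ 4 = Real.log T) :
    ∃ A : LearningAlgorithm T, A.stochasticRegret ≤ ((35 * (T * d) : ℝ) : EReal) := by
  have hT' : (2 : ℝ) ≤ T := by exact_mod_cast hT
  have hT0 : (0 : ℝ) < T := by linarith
  set L := Real.log T
  have hL : 1 / 2 ≤ L :=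
    (by linarith [Real.log_two_gt_d9] : (1 : ℝ) / 2 ≤ Real.log 2).trans
      (Real.log_le_log two_pos hT')
  have hTd : 0 < T * d := by positivity
  have hmpos : 0 < ⌈T * d⌉₊ := Nat.ceil_pos.2 hTd
  have hGpos : 0 < ⌈1 / d⌉₊ := Nat.ceil_pos.2 (by positivity)
  obtain ⟨A, hA⟩ := exists_stochasticRegret_le T hGpos hmpos (s := 2 * d) (by positivity)
  refine ⟨A, hA.trans (EReal.coe_le_coe ?_)⟩
  set m : ℝ := (⌈T * d⌉₊ : ℝ) with hm
  set g : ℝ := (⌈1 / d⌉₊ : ℝ) with hg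
  have hm1 : T * d ≤ m := Nat.le_ceil _
  have hm2 : m < T * d + 1 := Nat.ceil_lt_add_one hTd.le
  have hg1 : 1 / d ≤ g := Nat.le_ceil _
  have hg2 : g < 1 / d + 1 := Nat.ceil_lt_add_one (by positivity)
  have hg0 : 0 < g := by positivity
  have hm0 : 0 < m := by linarith
  have hgd : 1 ≤ g * d := (div_le_iff₀ hd).1 hg1
  have hgd2 : g * d ≤ 2 := by
    have : g * d < (1 / d + 1) * d := mul_lt_mul_of_pos_right hg2 hd
    have h2 : (1 / d + 1) * d = 1 + d := by field_simp
    linarith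
  -- Smallness of `d` and `T * d ^ 4 = L ≥ 1 / 2` make `T * d ^ 2`, `T * d ^ 3` and `T * d` large
  -- enough to absorb the ceilings. The losses then add up to at most `(2 + 4 + 8 + 4 + 1) * (T * d)
  -- + 4`, well below `35 * (T * d)`.
  have hd3 : d ^ 2 ≤ 1 / 100 := by nlinarith
  have hTd2 : 50 ≤ T * d ^ 2 := by
    have : T * d ^ 2 * d ^ 2 = L := by rw [← hdT]; ring
    by_contra hlt
    nlinarith [mul_pos hT0 (pow_pos hd 2), pow_pos hd 2]
  have hTd3 : 2 ≤ T * d * d * d := by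
    have : T * d * d * d * d = L := by rw [← hdT]; ring
    by_contra hlt
    nlinarith
  have hTd1 : 50 ≤ T * d := by nlinarith
  have e1 : T * (2 / g) ≤ 2 * (T * d) := by
    rw [mul_div_assoc', div_le_iff₀ hg0]
    nlinarith
  have e2 : T * (4 * (2 * g) / (m + 1)) ≤ 8 * (T * d) := by
    rw [mul_div_assoc', div_le_iff₀ (by linarith)]
    have h1 : g ≤ T * d * d := by
      have : g * d ≤ T * d * d * d := by linarith
      exact le_of_mul_le_mul_right this hd
    nlinarith
  have e3 : T * (Real.log ((m + 1) ^ (2 * (2 * ⌈1 / d⌉₊))) / (m * (2 * d))) ≤ 4 * (T * d) := by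
    have hmT : m + 1 ≤ T := by nlinarith
    have hlog : Real.log ((m + 1) ^ (2 * (2 * ⌈1 / d⌉₊))) ≤ 4 * g * L := by
      rw [Real.log_pow]
      push_cast
      have : Real.log (m + 1) ≤ L := Real.log_le_log (by linarith) hmT
      nlinarith
    rw [mul_div_assoc', div_le_iff₀ (by positivity)]
    calc T * Real.log ((m + 1) ^ (2 * (2 * ⌈1 / d⌉₊))) ≤ T * (4 * g * L) := by gcongr
      _ = 4 * (T * d) * ((T * d) * (g * d)) * d := by rw [← hdT]; ring
      _ ≤ 4 * (T * d) * (m * 2) * d := by gcongr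
      _ = _ := by ring
  have e4 : T * (2 * d / 2) = T * d := by ring
  rw [mul_add, mul_add, e4]
  linarith

end JointAds

end

theorem mainTheorem1 (T : ℕ) (hT : 2 ≤ T) :
    ∃ A : JointAds.LearningAlgorithm T,
      A.stochasticRegret ≤ ((35 * ((T : ℝ) ^ 3 * Real.log T) ^ (1 / 4 : ℝ) : ℝ) : EReal) := by
  have hT' : (2 : ℝ) ≤ T := by exact_mod_cast hT
  have hT0 : (0 : ℝ) < T := by linarith
  have hL : 0 < Real.log T := Real.log_pos (by linarith)
  set d : ℝ := (Real.log T / T) ^ (1 / 4 : ℝ) with hd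
  have hd0 : 0 < d := by positivity
  have hd4 : d ^ 4 = Real.log T / T := by
    rw [hd, ← Real.rpow_natCast, ← Real.rpow_mul (by positivity)]
    norm_num
  have hdT : T * d ^ 4 = Real.log T := by
    rw [hd4]
    field_simp
  have hrw : ((T : ℝ) ^ 3 * Real.log T) ^ (1 / 4 : ℝ) = T * d := by
    have : (T : ℝ) ^ 3 * Real.log T = (T * d) ^ (4 : ℝ) := by
      rw [← hdT, show (4 : ℝ) = (4 : ℕ) by norm_num, Real.rpow_natCast]
      ring
    rw [this, ← Real.rpow_mul (by positivity)]
    norm_num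
  rw [hrw]
  -- For `d ≥ 2 / 35` the claimed bound is at least `2 * T`, which every algorithm satisfies since
  -- revenues lie in `[0,2]`.
  by_cases h : d < 2 / 35
  · exact JointAds.exists_stochasticRegret_le_of_pow hT hd0 h hdT
  · obtain ⟨A, -⟩ := JointAds.exists_stochasticRegret_le T one_pos one_pos one_pos
    refine ⟨A, A.stochasticRegret_le_two_mul.trans (EReal.coe_le_coe ?_)⟩
    nlinarith
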